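/- Let $f$ be holomorphic and univalent (that is, injective) in the unit disk $\{z\in\mathbb{C}:|z|<1\}$, with $|f(z)|<1$ for $|z|<1$ and Taylor expansion $f(z)=c_1z+\dots$ at $0$, so that $f(0)=0$ and $c_1=f'(0)$. Then $$|S_f(0)|\le 6\,(1-|c_1|^2),$$ where $S_f=\left(\frac{f''}{f'}\right)'-\frac12\left(\frac{f''}{f'}\right)^2$ is the Schwarzian derivative of $f$. -/

import Mathlib

/-- The Schwarzian derivative `S_f = (f'' / f')' - (1/2) (f'' / f')²` of a function of one complex
variable (meaningful where `f` is holomorphic with `f' ≠ 0`). -/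
noncomputable def schwarzian (f : ℂ → ℂ) (z : ℂ) : ℂ :=
  deriv (fun w => deriv (deriv f) w / deriv f w) z
    - (1 / 2) * (deriv (deriv f) z / deriv f z) ^ 2

/-! Write `f z = z * (c + z * ψ z)`. For `‖ε‖ = 1` the map `w ↦ w⁻¹ - ε * w` is injective on the
punctured unit disk, so `c * ((f z)⁻¹ - ε * f z) = z⁻¹ + H z` is univalent there, with `H`
holomorphic on the disk. The area theorem gives `‖deriv H 0‖ ≤ 1`, and `-deriv H 0` is `schwarzian f
0 / 6 + ε * c ^ 2`. Choosing `ε` to align the two terms yields the claim.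

The area theorem comes from two estimates for the area of the image of `ρ < ‖z‖ < 1` under `z⁻¹ + H
z`. With `β = deriv H 0`, the circle of radius `ρ` is carried close to an ellipse, which the map `w
↦ w - a * conj w`, `a = β * ρ ^ 2`, turns into a circle. The annulus is mapped inside a slightly
larger ellipse, of area at most `π / ρ ^ 2 + O(ρ)`. Integrating the squared derivative bounds the
same area below by `π (1 / ρ ^ 2 - 1) + π ‖β‖ ^ 2 (1 - ρ ^ 2)`. Compare and let `ρ → 0`. -/

/-! ### Two facts on injectivity -/

open Metric Set Filter Topology Complex in
-- At a critical point `f - f z₀` is locally `P ^ n` with `n ≥ 2` and `P` locally invertible. Points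
-- where `P` takes the values `w` and `ω * w`, with `ω` a primitive `n`-th root of unity, then share
-- the same value of `f`.
theorem deriv_ne_zero_of_analyticAt_of_injOn {f : ℂ → ℂ} {z₀ : ℂ} {s : Set ℂ}
    (hf : AnalyticAt ℂ f z₀) (hs : s ∈ 𝓝 z₀) (hinj : InjOn f s) : deriv f z₀ ≠ 0 := by
  intro hd
  have hg : AnalyticAt ℂ (fun z => f z - f z₀) z₀ := hf.sub analyticAt_const
  have hnc : ¬ ∀ᶠ z in 𝓝 z₀, f z - f z₀ = 0 := by
    intro h
    have h1 : ∀ᶠ z in 𝓝[≠] z₀, f z - f z₀ = 0 ∧ z ∈ s :=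
      (h.and hs).filter_mono nhdsWithin_le_nhds
    obtain ⟨z, ⟨hz, hzs⟩, hne⟩ := (h1.and self_mem_nhdsWithin).exists
    exact hne (hinj hzs (mem_of_mem_nhds hs) (sub_eq_zero.1 hz))
  obtain ⟨n, h, hh, hh0, hfac⟩ := hg.exists_eventuallyEq_pow_smul_nonzero_iff.2 hnc
  have hn : 2 ≤ n := by
    have hn0 : n ≠ 0 := by
      rintro rfl
      have := hfac.self_of_nhds
      simp at this
      exact hh0 this.symm
    have hn1 : n ≠ 1 := by
      rintro rfl
      have h1 : HasDerivAt (fun z => (z - z₀) ^ 1 • h z) (h z₀) z₀ := by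
        have := ((hasDerivAt_id z₀).sub_const z₀).mul hh.differentiableAt.hasDerivAt
        simpa using! this
      have h2 := h1.congr_of_eventuallyEq hfac
      have h3 : HasDerivAt (fun z => f z - f z₀) (deriv f z₀) z₀ :=
        hf.differentiableAt.hasDerivAt.sub_const _
      exact hh0 (by rw [h2.unique h3, hd])
    omega
  have hn0 : (n : ℂ) ≠ 0 := by exact_mod_cast (by omega : n ≠ 0)
  -- A local `n`-th root of `h`; dividing by `h z₀` keeps the argument of the logarithm near `1`,
  -- off the branch cut.
  set k : ℂ → ℂ := fun z => exp (log (h z₀) / n) * exp (log (h z / h z₀) / n) with hk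
  have hslit : h z₀ / h z₀ ∈ slitPlane := by simp [hh0]
  have hka : AnalyticAt ℂ k z₀ := by
    have : AnalyticAt ℂ (fun z => log (h z / h z₀)) z₀ :=
      (hh.div analyticAt_const hh0).clog hslit
    exact analyticAt_const.mul (this.div analyticAt_const hn0).cexp
  have hkn : ∀ᶠ z in 𝓝 z₀, k z ^ n = h z := by
    filter_upwards [hh.continuousAt.eventually_ne hh0] with z hz
    simp only [hk, mul_pow, ← exp_nat_mul, mul_div_cancel₀ _ hn0]
    rw [exp_log hh0, exp_log (div_ne_zero hz hh0), mul_div_cancel₀ _ hh0]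
  set P : ℂ → ℂ := fun z => (z - z₀) * k z with hP
  have hPa : AnalyticAt ℂ P z₀ := (analyticAt_id.sub analyticAt_const).mul hka
  have hPd : HasStrictDerivAt P (k z₀) z₀ := by
    have := ((hasDerivAt_id z₀).sub_const z₀).mul hka.differentiableAt.hasDerivAt
    have h1 : deriv P z₀ = k z₀ := HasDerivAt.deriv (by simpa using! this)
    exact h1 ▸ hPa.hasStrictDerivAt
  have hP0 : P z₀ = 0 := by simp [hP]
  have hmap := hPd.map_nhds_eq (by simp [hk, exp_ne_zero])
  rw [hP0] at hmap
  set t : Set ℂ := {z | z ∈ s ∧ f z - f z₀ = P z ^ n}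
  have ht : t ∈ 𝓝 z₀ := by
    filter_upwards [hs, hfac, hkn] with z h1 h2 h3
    exact ⟨h1, by rw [h2, hP, mul_pow, h3, smul_eq_mul]⟩
  have hPt : P '' t ∈ 𝓝 (0 : ℂ) := hmap ▸ image_mem_map ht
  have hω := isPrimitiveRoot_exp n (by omega)
  set ω := exp (2 * Real.pi * I / n)
  have h2 : ∀ᶠ w in 𝓝 (0 : ℂ), ω * w ∈ P '' t := by
    have : Tendsto (fun w : ℂ => ω * w) (𝓝 0) (𝓝 0) := by
      simpa using (continuous_const_mul ω).tendsto 0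
    exact this hPt
  have h3 : ∀ᶠ w in 𝓝[≠] (0 : ℂ), w ∈ P '' t ∧ ω * w ∈ P '' t :=
    ((show ∀ᶠ w in 𝓝 (0 : ℂ), w ∈ P '' t from hPt).and h2).filter_mono nhdsWithin_le_nhds
  obtain ⟨w, ⟨⟨a, ha, haw⟩, ⟨b, hb, hbw⟩⟩, hw⟩ := (h3.and self_mem_nhdsWithin).exists
  have hab : a = b := by
    refine hinj ha.1 hb.1 (sub_left_injective (b := f z₀) ?_)
    change f a - f z₀ = f b - f z₀
    rw [ha.2, hb.2, haw, hbw, mul_pow, hω.pow_eq_one, one_mul]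
  have hwω : ω * w = 1 * w := by rw [← hbw, ← hab, haw, one_mul]
  exact hω.ne_one (by omega) (mul_right_cancel₀ hw hwω)

open Metric Set Filter Topology Complex in
-- Equal values force `(w - v) * (1 + ε * w * v) = 0`, and `‖ε * w * v‖ < 1` excludes the second
-- factor.
theorem injOn_inv_sub_mul {ε : ℂ} (hε : ‖ε‖ = 1) :
    InjOn (fun w : ℂ => w⁻¹ - ε * w) (ball 0 1 \ {0}) := by
  rintro w ⟨hw, hw0⟩ v ⟨hv, hv0⟩ h
  rw [mem_ball_zero_iff] at hw hv
  have hw0' : w ≠ 0 := hw0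
  have hv0' : v ≠ 0 := hv0
  have h1 : (w - v) * (1 + ε * (w * v)) = 0 := by
    simp only at h
    field_simp at h
    linear_combination -h
  rcases mul_eq_zero.1 h1 with h2 | h2
  · exact sub_eq_zero.1 h2
  · exfalso
    have h3 : ‖ε * (w * v)‖ = 1 := by
      rw [eq_neg_of_add_eq_zero_right h2]; simp
    rw [norm_mul, norm_mul, hε, one_mul] at h3
    nlinarith [norm_nonneg w, norm_nonneg v]

/-! ### The Schwarzian in Taylor coefficients -/

open Metric Set Filter Topology Complex in
theorem schwarzian_eq_of_eventuallyEq {f ψ : ℂ → ℂ} {c : ℂ} (hψ : AnalyticAt ℂ ψ 0)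
    (hf : f =ᶠ[𝓝 0] fun z => z * (c + z * ψ z)) (hc : c ≠ 0) :
    schwarzian f 0 = 6 * ((deriv ψ 0 * c - ψ 0 ^ 2) / c ^ 2) := by
  have hψ1 := hψ.eventually_analyticAt
  have hd1 : deriv f =ᶠ[𝓝 0] fun z => c + 2 * z * ψ z + z ^ 2 * deriv ψ z := by
    refine hf.deriv.trans ?_
    filter_upwards [hψ1] with z hz
    have h := (hasDerivAt_id z).mul
      (((hasDerivAt_id z).mul hz.differentiableAt.hasDerivAt).const_add c)
    refine HasDerivAt.deriv (h.congr_deriv ?_ |>.congr_of_eventuallyEq ?_)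
    · simp; ring
    · exact Eventually.of_forall fun y => by simp
  have hd2 : deriv (deriv f) =ᶠ[𝓝 0]
      fun z => 2 * ψ z + 4 * z * deriv ψ z + z ^ 2 * deriv (deriv ψ) z := by
    refine hd1.deriv.trans ?_
    filter_upwards [hψ1] with z hz
    have h := ((((hasDerivAt_id z).const_mul 2).mul hz.differentiableAt.hasDerivAt).const_add c).add
      ((hasDerivAt_pow 2 z).mul hz.deriv.differentiableAt.hasDerivAt)
    refine HasDerivAt.deriv (h.congr_deriv ?_ |>.congr_of_eventuallyEq ?_)
    · simp; ring
    · exact Eventually.of_forall fun y => by simp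
  have e1 : deriv f 0 = c := by rw [hd1.self_of_nhds]; simp
  have e2 : deriv (deriv f) 0 = 2 * ψ 0 := by rw [hd2.self_of_nhds]; simp
  have h1 : HasDerivAt (deriv f) (2 * ψ 0) 0 := by
    have := (((hasDerivAt_id (0 : ℂ)).const_mul 2).mul
      hψ.differentiableAt.hasDerivAt).const_add c |>.add
      ((hasDerivAt_pow 2 0).mul hψ.deriv.differentiableAt.hasDerivAt)
    refine (this.congr_deriv ?_).congr_of_eventuallyEq (hd1.trans ?_)
    · simp
    · exact Eventually.of_forall fun y => by simp
  have h2 : HasDerivAt (deriv (deriv f)) (6 * deriv ψ 0) 0 := by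
    have := ((hψ.differentiableAt.hasDerivAt.const_mul 2).add
      (((hasDerivAt_id (0 : ℂ)).const_mul 4).mul hψ.deriv.differentiableAt.hasDerivAt)).add
      ((hasDerivAt_pow 2 0).mul hψ.deriv.deriv.differentiableAt.hasDerivAt)
    refine (this.congr_deriv ?_).congr_of_eventuallyEq (hd2.trans ?_)
    · simp; ring
    · exact Eventually.of_forall fun y => by simp
  have h3 := (h2.div h1 (by rwa [e1])).deriv
  have h4 : deriv (fun w => deriv (deriv f) w / deriv f w) 0 =
    (6 * deriv ψ 0 * c - 2 * ψ 0 * (2 * ψ 0)) / c ^ 2 := by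
    rw [e1, e2] at h3
    exact h3
  rw [schwarzian, h4, e1, e2]
  field_simp
  ring

/-! ### Ellipses: connected exterior and area -/

open Metric Set Filter Topology Complex in
theorem Complex.isPreconnected_compl_closedBall_zero (r : ℝ) :
    IsPreconnected (closedBall (0 : ℂ) r)ᶜ := by
  rcases lt_or_ge r 0 with hr | hr
  · rw [closedBall_eq_empty.2 hr, compl_empty]; exact isPreconnected_univ
  rcases hr.eq_or_lt with rfl | hr
  · rw [closedBall_zero]
    exact (isConnected_compl_singleton_of_one_lt_rank (by simp) 0).isPreconnected
  -- For `r > 0` the exterior is the exponential of a half-plane.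
  have : (closedBall (0 : ℂ) r)ᶜ = exp '' {z | Real.log r < z.re} := by
    ext z
    simp only [mem_compl_iff, mem_closedBall_zero_iff, not_le, mem_image, mem_ofPred_eq]
    constructor
    · intro hz
      refine ⟨log z, ?_, exp_log (norm_pos_iff.1 (hr.trans hz))⟩
      rw [log_re]; exact Real.log_lt_log hr hz
    · rintro ⟨w, hw, rfl⟩
      rw [norm_exp]
      exact (Real.log_lt_iff_lt_exp hr).1 hw
  rw [this]
  exact (convex_halfSpace_re_gt _).isPreconnected.image _ continuous_exp.continuousOn

/-- The real-linear map `w ↦ w - a * conj w`. -/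
noncomputable def Complex.subMulConj (a : ℂ) : ℂ →L[ℝ] ℂ :=
  ContinuousLinearMap.id ℝ ℂ -
    (ContinuousLinearMap.mul ℝ ℂ a).comp Complex.conjCLE.toContinuousLinearMap

open ComplexConjugate in
@[simp]
theorem Complex.subMulConj_apply (a w : ℂ) : Complex.subMulConj a w = w - a * conj w := by
  simp [Complex.subMulConj]

theorem Complex.det_subMulConj (a : ℂ) :
    LinearMap.det (Complex.subMulConj a : ℂ →ₗ[ℝ] ℂ) = 1 - ‖a‖ ^ 2 := by
  rw [← LinearMap.det_toMatrix Complex.basisOneI, Matrix.det_fin_two]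
  simp [LinearMap.toMatrix_apply, Complex.sq_norm, Complex.normSq_apply]
  ring

theorem Complex.norm_subMulConj_le (a w : ℂ) : ‖Complex.subMulConj a w‖ ≤ (1 + ‖a‖) * ‖w‖ := by
  rw [Complex.subMulConj_apply]
  refine (norm_sub_le _ _).trans (le_of_eq ?_)
  simp; ring

theorem Complex.le_norm_subMulConj (a w : ℂ) : (1 - ‖a‖) * ‖w‖ ≤ ‖Complex.subMulConj a w‖ := by
  rw [Complex.subMulConj_apply]
  refine le_trans (le_of_eq ?_) (norm_sub_norm_le _ _)
  simp; ring

open ComplexConjugate in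
theorem Complex.subMulConj_subMulConj_neg (a w : ℂ) :
    Complex.subMulConj a (Complex.subMulConj (-a) w) = (1 - ‖a‖ ^ 2 : ℝ) * w := by
  have : a * conj a = ((‖a‖ ^ 2 : ℝ) : ℂ) := by rw [Complex.mul_conj, Complex.normSq_eq_norm_sq]
  simp only [Complex.subMulConj_apply, map_sub, map_mul, map_neg, Complex.conj_conj]
  push_cast at *
  linear_combination -w * this

open Metric Set Filter Topology Complex in
-- Up to a nonzero real factor `subMulConj (-a)` inverts `subMulConj a`, so the set is an affine
-- image of the exterior of a disk.
theorem Complex.isPreconnected_setOf_lt_norm_subMulConj {a : ℂ} (ha : ‖a‖ < 1) (b : ℂ) (r : ℝ) :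
    IsPreconnected {w : ℂ | r < ‖subMulConj a (w - b)‖} := by
  have hδ : 0 < 1 - ‖a‖ ^ 2 := by nlinarith [norm_nonneg a]
  have hδ' : ((1 - ‖a‖ ^ 2 : ℝ) : ℂ) ≠ 0 := by exact_mod_cast hδ.ne'
  have : {w : ℂ | r < ‖subMulConj a (w - b)‖} =
      (fun ζ => subMulConj (-a) (((1 - ‖a‖ ^ 2 : ℝ) : ℂ)⁻¹ * ζ) + b) '' (closedBall 0 r)ᶜ := by
    ext w
    simp only [mem_ofPred_eq, mem_image, mem_compl_iff, mem_closedBall_zero_iff, not_le]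
    constructor
    · intro hw
      refine ⟨_, hw, ?_⟩
      have h1 : ((1 - ‖a‖ ^ 2 : ℝ) : ℂ)⁻¹ * subMulConj a (w - b) =
          subMulConj a (((1 - ‖a‖ ^ 2 : ℝ) : ℂ)⁻¹ * (w - b)) := by
        simp only [subMulConj_apply, map_mul, ← ofReal_inv, conj_ofReal]; ring
      have h2 := subMulConj_subMulConj_neg (-a) (((1 - ‖a‖ ^ 2 : ℝ) : ℂ)⁻¹ * (w - b))
      rw [neg_neg, norm_neg, mul_inv_cancel_left₀ hδ'] at h2
      rw [h1, h2, sub_add_cancel]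
    · rintro ⟨ζ, hζ, rfl⟩
      rwa [add_sub_cancel_right, subMulConj_subMulConj_neg, mul_inv_cancel_left₀ hδ']
  rw [this]
  exact (isPreconnected_compl_closedBall_zero r).image _ (by fun_prop)

open Metric Set Filter Topology Complex MeasureTheory in
theorem Complex.volume_setOf_norm_subMulConj_le {a : ℂ} (ha : ‖a‖ < 1) (b : ℂ) {r : ℝ}
    (hr : 0 ≤ r) :
    volume {w : ℂ | ‖subMulConj a (w - b)‖ ≤ r} =
      ENNReal.ofReal (Real.pi * r ^ 2 / (1 - ‖a‖ ^ 2)) := by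
  have hδ : 0 < 1 - ‖a‖ ^ 2 := by nlinarith [norm_nonneg a]
  have h1 : {w : ℂ | ‖subMulConj a (w - b)‖ ≤ r} =
      (fun w => w + -b) ⁻¹' (subMulConj a ⁻¹' closedBall 0 r) := by
    ext; simp [sub_eq_add_neg]
  rw [h1, measure_preimage_add_right, Measure.addHaar_preimage_continuousLinearMap, det_subMulConj,
    Complex.volume_closedBall, abs_of_pos (inv_pos.2 hδ), ← ENNReal.ofReal_coe_nnreal,
    ← ENNReal.ofReal_pow hr, ← ENNReal.ofReal_mul (by positivity),
    ← ENNReal.ofReal_mul (by positivity), NNReal.coe_real_pi]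
  · congr 1; field_simp
  · rw [det_subMulConj]; exact hδ.ne'

/-! ### Upper bound for the area of the image of an annulus -/

open Metric Set Filter Topology Complex in
theorem image_punctured_ball_isOpen {H : ℂ → ℂ} (hH : DifferentiableOn ℂ H (ball 0 1))
    (hinj : InjOn (fun z => z⁻¹ + H z) (ball 0 1 \ {0})) {s : Set ℂ} (hs : IsOpen s)
    (hs1 : s ⊆ ball 0 1 \ {0}) : IsOpen ((fun z => z⁻¹ + H z) '' s) := by
  have hopen : IsOpen (ball (0 : ℂ) 1 \ {0}) := isOpen_ball.sdiff isClosed_singleton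
  have hd : DifferentiableOn ℂ (fun z => z⁻¹ + H z) (ball 0 1 \ {0}) :=
    (differentiableOn_inv.mono fun z hz => hz.2).add (hH.mono sdiff_subset)
  rw [isOpen_iff_mem_nhds]
  rintro _ ⟨z, hz, rfl⟩
  have ha := hd.analyticAt (hopen.mem_nhds (hs1 hz))
  have := ha.hasStrictDerivAt.map_nhds_eq
    (deriv_ne_zero_of_analyticAt_of_injOn ha (hopen.mem_nhds (hs1 hz)) hinj)
  rw [← this]
  exact image_mem_map (hs.mem_nhds hz)

open Metric Set Filter Topology Complex in
/-- If a set `{w | r < ‖L (w - b)‖}`, `L = subMulConj a`, does not meet the image of the circle of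
radius `ρ`, it lies in the image of the punctured disk of radius `ρ`. -/
theorem setOf_lt_norm_subMulConj_subset_image {H : ℂ → ℂ} (hH : DifferentiableOn ℂ H (ball 0 1))
    (hinj : InjOn (fun z => z⁻¹ + H z) (ball 0 1 \ {0})) {ρ : ℝ} (hρ : 0 < ρ) (hρ1 : ρ < 1)
    {a b : ℂ} (ha : ‖a‖ < 1) {r : ℝ}
    (hcirc : ∀ z, ‖z‖ = ρ → ‖subMulConj a (z⁻¹ + H z - b)‖ ≤ r) :
    {w : ℂ | r < ‖subMulConj a (w - b)‖} ⊆ (fun z => z⁻¹ + H z) '' (ball 0 ρ \ {0}) := by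
  set F : ℂ → ℂ := fun z => z⁻¹ + H z with hF
  have hinf : Tendsto (fun z => ‖F z‖) (𝓝[≠] 0) atTop := by
    have h1 : Tendsto (fun z : ℂ => z⁻¹) (𝓝[≠] 0) (Bornology.cobounded ℂ) :=
      tendsto_inv₀_nhdsNE_zero
    have h2 : Tendsto H (𝓝[≠] 0) (𝓝 (H 0)) :=
      ((hH.differentiableAt (ball_mem_nhds _ one_pos)).continuousAt.tendsto).mono_left
        nhdsWithin_le_nhds
    have h3 : Tendsto (fun z => ‖z⁻¹‖ + -‖H z‖) (𝓝[≠] 0) atTop :=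
      (tendsto_norm_cobounded_atTop.comp h1).atTop_add h2.norm.neg
    refine tendsto_atTop_mono (fun z => ?_) h3
    have := norm_sub_norm_le (z⁻¹) (-H z)
    simpa [hF, ← sub_eq_add_neg] using this
  have hb1 : ball (0 : ℂ) ρ ∈ 𝓝 0 := ball_mem_nhds _ hρ
  -- The image is open, meets the connected exterior because of the pole, and is relatively closed
  -- in it; hence it contains it.
  refine (isPreconnected_setOf_lt_norm_subMulConj ha b r).subset_of_closure_inter_subset
    (image_punctured_ball_isOpen hH hinj (isOpen_ball.sdiff isClosed_singleton)
      (sdiff_subset_sdiff_left (ball_subset_ball hρ1.le))) ?_ ?_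
  · have h1 : ∀ᶠ z in 𝓝[≠] (0 : ℂ), (r + 1) / (1 - ‖a‖) + ‖b‖ < ‖F z‖ :=
      hinf.eventually_gt_atTop _
    have h2 : ∀ᶠ z in 𝓝[≠] (0 : ℂ), z ∈ ball (0 : ℂ) ρ := mem_nhdsWithin_of_mem_nhds hb1
    obtain ⟨z, ⟨hz1, hz2⟩, hz0⟩ := ((h1.and h2).and self_mem_nhdsWithin).exists
    refine ⟨F z, ?_, z, ⟨hz2, hz0⟩, rfl⟩
    have h3 := le_norm_subMulConj a (F z - b)
    have h4 := norm_sub_norm_le (F z) b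
    have h5 : (r + 1) / (1 - ‖a‖) ≤ ‖F z - b‖ := by linarith
    rw [div_le_iff₀ (by linarith)] at h5
    change r < _
    linarith
  · rintro w ⟨hw, hwr⟩
    obtain ⟨δ, hδ, hδF⟩ : ∃ δ > 0, ∀ z ∈ ball (0 : ℂ) δ, z ≠ 0 → ‖w‖ + 1 ≤ ‖F z‖ := by
      have h1 : ∀ᶠ z in 𝓝[≠] (0 : ℂ), ‖w‖ + 1 ≤ ‖F z‖ := hinf.eventually_ge_atTop _
      rw [eventually_nhdsWithin_iff] at h1
      exact Metric.mem_nhds_iff.1 h1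
    have hK : IsCompact (closedBall (0 : ℂ) ρ \ ball 0 δ) :=
      (isCompact_closedBall 0 ρ).diff isOpen_ball
    have hFc : ContinuousOn F (closedBall (0 : ℂ) ρ \ ball 0 δ) := by
      refine (continuousOn_inv₀.mono ?_).add (hH.continuousOn.mono ?_)
      · rintro z hz rfl
        exact hz.2 (mem_ball_self hδ)
      · exact sdiff_subset.trans (closedBall_subset_ball hρ1)
    -- Near the pole the values stay far from `w`, so a limit `w` of image points is attained on the
    -- compact remainder.
    have hcl : IsClosed (F '' (closedBall (0 : ℂ) ρ \ ball 0 δ) ∪ {v | ‖w‖ + 1 ≤ ‖v‖}) :=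
      (hK.image_of_continuousOn hFc).isClosed.union (isClosed_le continuous_const continuous_norm)
    have hsub : F '' (ball 0 ρ \ {0}) ⊆
        F '' (closedBall (0 : ℂ) ρ \ ball 0 δ) ∪ {v | ‖w‖ + 1 ≤ ‖v‖} := by
      rintro _ ⟨z, hz, rfl⟩
      by_cases hzδ : z ∈ ball 0 δ
      · exact Or.inr (hδF z hzδ hz.2)
      · exact Or.inl ⟨z, ⟨ball_subset_closedBall hz.1, hzδ⟩, rfl⟩
    rcases closure_minimal hsub hcl hw with ⟨z, ⟨hz, hzδ⟩, rfl⟩ | h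
    · refine ⟨z, ⟨?_, ?_⟩, rfl⟩
      · rw [mem_closedBall_zero_iff] at hz
        rw [mem_ball_zero_iff]
        refine hz.lt_of_ne fun h => ?_
        exact absurd (hcirc z h) (not_le.2 hwr)
      · rintro rfl
        exact hzδ (mem_ball_self hδ)
    · simp at h
      linarith

open Metric Set Filter Topology Complex MeasureTheory in
-- The exterior of the ellipse is already covered by the punctured disk of radius `ρ`, so
-- injectivity keeps the image of the annulus inside the ellipse.
theorem volume_image_annulus_le {H : ℂ → ℂ} (hH : DifferentiableOn ℂ H (ball 0 1))
    (hinj : InjOn (fun z => z⁻¹ + H z) (ball 0 1 \ {0})) {ρ : ℝ} (hρ : 0 < ρ) (hρ1 : ρ < 1)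
    {a b : ℂ} (ha : ‖a‖ < 1) {r : ℝ} (hr : 0 ≤ r)
    (hcirc : ∀ z, ‖z‖ = ρ → ‖subMulConj a (z⁻¹ + H z - b)‖ ≤ r) :
    volume ((fun z => z⁻¹ + H z) '' (ball 0 1 \ closedBall 0 ρ)) ≤
      ENNReal.ofReal (Real.pi * r ^ 2 / (1 - ‖a‖ ^ 2)) := by
  rw [← volume_setOf_norm_subMulConj_le ha b hr]
  refine measure_mono ?_
  rintro _ ⟨z, ⟨hz, hzρ⟩, rfl⟩
  by_contra h
  obtain ⟨w, hw, hwz⟩ := setOf_lt_norm_subMulConj_subset_image hH hinj hρ hρ1 ha hcirc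
    (show r < _ from not_le.1 h)
  have hz0 : z ≠ 0 := by
    rintro rfl
    exact hzρ (mem_closedBall_self hρ.le)
  have := hinj ⟨ball_subset_ball hρ1.le hw.1, hw.2⟩ ⟨hz, hz0⟩ hwz
  exact hzρ (this ▸ ball_subset_closedBall hw.1)

/-! ### Lower bound for the area, and the area theorem -/

open ComplexConjugate in
open Metric Set Filter Topology Complex MeasureTheory in
theorem integral_norm_sq_circle_ge {k : ℂ → ℂ} (hk : DifferentiableOn ℂ k (ball 0 1)) {r : ℝ}
    (hr : 0 < r) (hr1 : r < 1) :
    2 * Real.pi * (1 / r ^ 4 + ‖k 0‖ ^ 2) ≤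
      ∫ θ in Ioo (-Real.pi) Real.pi, ‖-(circleMap 0 r θ ^ 2)⁻¹ + k (circleMap 0 r θ)‖ ^ 2 := by
  -- On the circle `(z ^ 2)⁻¹ = conj z ^ 2 / r ^ 4`, and `‖k z‖ ^ 2 ≥ 2 Re (conj (k 0) * k z) - ‖k
  -- 0‖ ^ 2`. The integrand is thus at least `Re G` plus a constant, and the mean of `Re G` is its
  -- value at `0`.
  set G : ℂ → ℂ := fun z => (-(2 / r ^ 4 : ℝ) * z ^ 2 + 2 * conj (k 0)) * k z with hG
  have hGd : DifferentiableOn ℂ G (ball 0 1) :=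
    (DifferentiableOn.add (by fun_prop) (by fun_prop)).mul hk
  have hmem : ∀ θ, circleMap 0 r θ ∈ ball (0 : ℂ) 1 := fun θ => by simp [abs_of_pos hr, hr1]
  have hGc : Continuous fun θ => G (circleMap 0 r θ) :=
    hGd.continuousOn.comp_continuous (continuous_circleMap 0 r) hmem
  have hkc : Continuous fun θ => k (circleMap 0 r θ) :=
    hk.continuousOn.comp_continuous (continuous_circleMap 0 r) hmem
  have hint : ∀ u : ℝ → ℝ, Continuous u → IntegrableOn u (Ioo (-Real.pi) Real.pi) := fun u hu =>
    hu.integrableOn_Icc.mono_set Ioo_subset_Icc_self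
  have hmean : ∫ θ in Ioo (-Real.pi) Real.pi, (G (circleMap 0 r θ)).re =
      2 * Real.pi * (2 * ‖k 0‖ ^ 2) := by
    have h1 : Real.circleAverage G 0 r = G 0 := by
      refine DiffContOnCl.circleAverage (hGd.mono ?_).diffContOnCl
      rw [abs_of_pos hr]
      exact closure_ball_subset_closedBall.trans (closedBall_subset_ball hr1)
    have h2 : Real.circleAverage (reCLM ∘ G) 0 r = (G 0).re := by
      rw [reCLM.circleAverage_comp_comm, h1]; · rfl
      exact (hGd.continuousOn.mono (by
        rw [abs_of_pos hr]
        exact sphere_subset_closedBall.trans (closedBall_subset_ball hr1))).circleIntegrable'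
    rw [Real.circleAverage_eq_integral_add (-Real.pi),
      intervalIntegral.integral_comp_add_right
        (fun θ => (reCLM ∘ G) (circleMap 0 r θ))] at h2
    rw [zero_add, show 2 * Real.pi + -Real.pi = Real.pi by ring,
      intervalIntegral.integral_of_le (by linarith [Real.pi_pos]), integral_Ioc_eq_integral_Ioo,
      smul_eq_mul, inv_mul_eq_iff_eq_mul₀ (by positivity)] at h2
    have h3 : (G 0).re = 2 * ‖k 0‖ ^ 2 := by
      have : G 0 = ((2 * ‖k 0‖ ^ 2 : ℝ) : ℂ) := by
        have := Complex.mul_conj (k 0)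
        rw [Complex.normSq_eq_norm_sq] at this
        push_cast at this ⊢
        simp only [hG]
        linear_combination 2 * this
      rw [this, ofReal_re]
    rw [h3] at h2
    exact h2
  have hlow : ∫ θ in Ioo (-Real.pi) Real.pi,
      ((G (circleMap 0 r θ)).re + (1 / r ^ 4 - ‖k 0‖ ^ 2)) =
      2 * Real.pi * (1 / r ^ 4 + ‖k 0‖ ^ 2) := by
    rw [integral_add (hint (fun θ => (G (circleMap 0 r θ)).re) (continuous_re.comp hGc)) (hint _ continuous_const), hmean]
    simp [Real.pi_pos.le]
    ring
  rw [← hlow]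
  have hne : ∀ θ, circleMap 0 r θ ^ 2 ≠ 0 := fun θ =>
    pow_ne_zero _ (circleMap_ne_center hr.ne')
  refine setIntegral_mono (hint _ ((continuous_re.comp hGc).add continuous_const))
    (hint _ (((((continuous_circleMap 0 r).pow 2).inv₀ hne).neg.add hkc).norm.pow 2)) fun θ => ?_
  set z := circleMap 0 r θ with hz
  have hzr : z * conj z = (r ^ 2 : ℝ) := by
    rw [Complex.mul_conj, Complex.normSq_eq_norm_sq, hz, norm_circleMap_zero, sq_abs]
  have hz2 : (z ^ 2)⁻¹ = conj z ^ 2 / (r ^ 4 : ℝ) := by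
    have hr0 : ((r ^ 4 : ℝ) : ℂ) ≠ 0 := by exact_mod_cast (pow_pos hr 4).ne'
    rw [eq_div_iff hr0, inv_mul_eq_iff_eq_mul₀ (hne θ), ← mul_pow, hzr]
    push_cast; ring
  have hnz : ‖(z ^ 2)⁻¹‖ ^ 2 = 1 / r ^ 4 := by
    rw [norm_inv, norm_pow, hz, norm_circleMap_zero, abs_of_pos hr]
    field_simp
  have e1 : ‖-(z ^ 2)⁻¹ + k z‖ ^ 2 =
      1 / r ^ 4 + ‖k z‖ ^ 2 - 2 / r ^ 4 * (z ^ 2 * k z).re := by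
    rw [← hnz, hz2, div_eq_mul_inv, ← ofReal_inv, mul_comm _ (((r ^ 4)⁻¹ : ℝ) : ℂ), div_eq_mul_inv]
    generalize (r ^ 4)⁻¹ = c
    rw [Complex.sq_norm, Complex.sq_norm, Complex.sq_norm]
    simp [Complex.normSq_apply, sq]
    ring
  have e2 : (G z).re = -(2 / r ^ 4) * (z ^ 2 * k z).re + 2 * (conj (k 0) * k z).re := by
    have : G z = ((-(2 / r ^ 4) : ℝ) : ℂ) * (z ^ 2 * k z) + ((2 : ℝ) : ℂ) * (conj (k 0) * k z) := by
      simp only [hG]; push_cast; ring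
    rw [this, add_re, re_ofReal_mul, re_ofReal_mul]
  have e3 : 2 * (conj (k 0) * k z).re ≤ ‖k z‖ ^ 2 + ‖k 0‖ ^ 2 := by
    simp only [Complex.sq_norm, Complex.normSq_apply, mul_re, conj_re, conj_im]
    nlinarith [sq_nonneg ((k 0).re - (k z).re), sq_nonneg ((k 0).im - (k z).im)]
  change (G z).re + (1 / r ^ 4 - ‖k 0‖ ^ 2) ≤ ‖-(z ^ 2)⁻¹ + k z‖ ^ 2
  rw [e1, e2]
  linarith

theorem integral_Ioo_inv_pow_three_add_mul {ρ : ℝ} (hρ : 0 < ρ) (hρ1 : ρ < 1) (β : ℝ) :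
    ∫ r in Set.Ioo ρ 1, r * (2 * Real.pi * (1 / r ^ 4 + β)) =
      Real.pi * (1 / ρ ^ 2 - 1) + Real.pi * β * (1 - ρ ^ 2) := by
  rw [← MeasureTheory.integral_Ioc_eq_integral_Ioo, ← intervalIntegral.integral_of_le hρ1.le,
    intervalIntegral.integral_eq_sub_of_hasDerivAt
      (f := fun r => Real.pi * (-(r ^ 2)⁻¹ + β * r ^ 2))]
  · field_simp
    ring
  · intro r hr
    rw [Set.uIcc_of_le hρ1.le] at hr
    have hr0 : r ≠ 0 := (hρ.trans_le hr.1).ne'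
    refine ((((hasDerivAt_pow 2 r).inv (pow_ne_zero 2 hr0)).neg.add
      ((hasDerivAt_pow 2 r).const_mul β)).const_mul Real.pi).congr_deriv ?_
    field_simp
    push_cast
    ring
  · refine ContinuousOn.intervalIntegrable fun r hr => ?_
    rw [Set.uIcc_of_le hρ1.le] at hr
    have hr0 : r ≠ 0 := (hρ.trans_le hr.1).ne'
    have : r ^ 4 ≠ 0 := pow_ne_zero 4 hr0
    exact ContinuousAt.continuousWithinAt (by fun_prop (disch := assumption))

open Metric Set Filter Topology Complex MeasureTheory in
theorem Complex.volume_image_eq_lintegral_norm_deriv_sq {F F' : ℂ → ℂ} {s : Set ℂ}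
    (hs : MeasurableSet s) (hF : ∀ z ∈ s, HasDerivAt F (F' z) z) (hinj : InjOn F s) :
    volume (F '' s) = ∫⁻ z in s, ENNReal.ofReal (‖F' z‖ ^ 2) := by
  rw [← lintegral_abs_det_fderiv_eq_addHaar_image volume hs
    (fun z hz => ((hF z hz).hasFDerivAt.restrictScalars ℝ).hasFDerivWithinAt) hinj]
  refine lintegral_congr fun z => ?_
  congr 1
  have : (ContinuousLinearMap.restrictScalars ℝ
      (ContinuousLinearMap.toSpanSingleton ℂ (F' z))).det = ‖F' z‖ ^ 2 := by
    rw [ContinuousLinearMap.det, ← LinearMap.det_toMatrix Complex.basisOneI, Matrix.det_fin_two]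
    simp [LinearMap.toMatrix_apply, Complex.sq_norm, Complex.normSq_apply]
  rw [this, abs_of_nonneg (by positivity)]

open Metric Set Filter Topology Complex MeasureTheory in
theorem Complex.setLIntegral_annulus {g : ℂ → ENNReal} (hg : Measurable g) {ρ : ℝ} (hρ : 0 < ρ) :
    ∫⁻ z in ball 0 1 \ closedBall 0 ρ, g z =
      ∫⁻ r in Ioo ρ 1, ENNReal.ofReal r *
        ∫⁻ θ in Ioo (-Real.pi) Real.pi, g (circleMap 0 r θ) := by
  have hA : MeasurableSet (ball (0 : ℂ) 1 \ closedBall 0 ρ) :=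
    measurableSet_ball.diff measurableSet_closedBall
  have hc : Continuous fun p : ℝ × ℝ => circleMap 0 p.1 p.2 := by
    unfold circleMap; fun_prop
  have hpol : ∀ p : ℝ × ℝ, Complex.polarCoord.symm p = circleMap 0 p.1 p.2 := fun p => by
    rw [Complex.polarCoord_symm_apply, circleMap, zero_add, exp_mul_I]
    push_cast
    rfl
  rw [← lintegral_indicator hA, ← Complex.lintegral_comp_polarCoord_symm]
  simp only [hpol, smul_eq_mul]
  have ht : polarCoord.target = Ioi (0 : ℝ) ×ˢ Ioo (-Real.pi) Real.pi := rfl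
  rw [ht, Measure.volume_eq_prod, ← Measure.prod_restrict, lintegral_prod _ (by
    exact ((ENNReal.measurable_ofReal.comp measurable_fst).mul
      ((hg.indicator hA).comp hc.measurable)).aemeasurable)]
  have h1 : Ioo ρ 1 = Ioi 0 ∩ Ioo ρ 1 := by
    rw [inter_eq_right.2]; exact fun r hr => hρ.trans hr.1
  rw [h1, inter_comm, ← Measure.restrict_restrict measurableSet_Ioo,
    ← lintegral_indicator measurableSet_Ioo]
  refine setLIntegral_congr_fun measurableSet_Ioi fun r (hr : 0 < r) => ?_
  have hmem : ∀ θ, circleMap 0 r θ ∈ ball (0 : ℂ) 1 \ closedBall 0 ρ ↔ r ∈ Ioo ρ 1 := fun θ => by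
    simp [abs_of_pos hr, and_comm]
  by_cases hr1 : r ∈ Ioo ρ 1
  · rw [indicator_of_mem hr1, ← lintegral_const_mul' _ _ ENNReal.ofReal_ne_top]
    refine lintegral_congr fun θ => ?_
    rw [indicator_of_mem ((hmem θ).2 hr1)]
  · rw [indicator_of_notMem hr1]
    refine (lintegral_congr fun θ => ?_).trans lintegral_zero
    rw [indicator_of_notMem (fun h => hr1 ((hmem θ).1 h)), mul_zero]

open Metric Set Filter Topology Complex MeasureTheory in
theorem volume_image_annulus_ge {H : ℂ → ℂ} (hH : DifferentiableOn ℂ H (ball 0 1))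
    (hinj : InjOn (fun z => z⁻¹ + H z) (ball 0 1 \ {0})) {ρ : ℝ} (hρ : 0 < ρ) (hρ1 : ρ < 1) :
    ENNReal.ofReal (Real.pi * (1 / ρ ^ 2 - 1) + Real.pi * ‖deriv H 0‖ ^ 2 * (1 - ρ ^ 2)) ≤
      volume ((fun z => z⁻¹ + H z) '' (ball 0 1 \ closedBall 0 ρ)) := by
  have hsub : ball (0 : ℂ) 1 \ closedBall 0 ρ ⊆ ball 0 1 \ {0} :=
    sdiff_subset_sdiff_right (singleton_subset_iff.2 (mem_closedBall_self hρ.le))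
  have hk : DifferentiableOn ℂ (deriv H) (ball 0 1) := hH.deriv isOpen_ball
  rw [Complex.volume_image_eq_lintegral_norm_deriv_sq
    (F := fun z => z⁻¹ + H z) (F' := fun z => -(z ^ 2)⁻¹ + deriv H z)
    (measurableSet_ball.diff measurableSet_closedBall)
    (fun z hz => (hasDerivAt_inv (hsub hz).2).add
      (hH.differentiableAt (isOpen_ball.mem_nhds hz.1)).hasDerivAt) (hinj.mono hsub),
    Complex.setLIntegral_annulus _ hρ]
  · rw [← integral_Ioo_inv_pow_three_add_mul hρ hρ1, ofReal_integral_eq_lintegral_ofReal]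
    · refine setLIntegral_mono' measurableSet_Ioo fun r hr => ?_
      have hr0 : 0 < r := hρ.trans hr.1
      rw [ENNReal.ofReal_mul hr0.le]
      gcongr
      refine (ENNReal.ofReal_le_ofReal (integral_norm_sq_circle_ge hk hr0 hr.2)).trans
        (le_of_eq (ofReal_integral_eq_lintegral_ofReal ?_ ?_))
      · have hc : Continuous fun θ =>
            ‖-(circleMap 0 r θ ^ 2)⁻¹ + deriv H (circleMap 0 r θ)‖ ^ 2 := by
          refine (((((continuous_circleMap 0 r).pow 2).inv₀ fun θ =>
            pow_ne_zero _ (circleMap_ne_center hr0.ne')).neg.add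
            (hk.continuousOn.comp_continuous (continuous_circleMap 0 r) fun θ => ?_)).norm.pow 2)
          simp [abs_of_pos hr0, hr.2]
        exact hc.integrableOn_Icc.mono_set Ioo_subset_Icc_self
      · exact Eventually.of_forall fun θ => by positivity
    · refine IntegrableOn.mono_set (ContinuousOn.integrableOn_Icc fun r hr => ?_) Ioo_subset_Icc_self
      have : r ^ 4 ≠ 0 := pow_ne_zero 4 (hρ.trans_le hr.1).ne'
      exact ContinuousAt.continuousWithinAt (by fun_prop (disch := assumption))
    · refine (ae_restrict_iff' measurableSet_Ioo).2 (Eventually.of_forall fun r hr => ?_)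
      have : 0 < r := hρ.trans hr.1
      positivity
  · have := measurable_deriv H
    fun_prop

open ComplexConjugate in
open Metric Set Filter Topology Complex MeasureTheory in
/-- The area theorem, for the first coefficient. -/
theorem norm_deriv_zero_le_one_of_injOn_inv_add {H : ℂ → ℂ}
    (hH : DifferentiableOn ℂ H (ball 0 1))
    (hinj : InjOn (fun z => z⁻¹ + H z) (ball 0 1 \ {0})) : ‖deriv H 0‖ ≤ 1 := by
  have hU : ball (0 : ℂ) 1 ∈ 𝓝 0 := ball_mem_nhds _ one_pos
  set β := deriv H 0 with hβ
  -- `M` bounds the second-order Taylor remainder, obtained by dividing by `z` twice.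
  obtain ⟨M, hM0, hM⟩ : ∃ M : ℝ, 0 ≤ M ∧
      ∀ z ∈ closedBall (0 : ℂ) (1 / 2), ‖H z - H 0 - β * z‖ ≤ M * ‖z‖ ^ 2 := by
    have h1 : DifferentiableOn ℂ (dslope H 0) (ball 0 1) := (differentiableOn_dslope hU).2 hH
    have h2 : DifferentiableOn ℂ (dslope (dslope H 0) 0) (ball 0 1) :=
      (differentiableOn_dslope hU).2 h1
    obtain ⟨M, hM⟩ := (isCompact_closedBall (0 : ℂ) (1 / 2)).exists_bound_of_continuousOn
      (h2.continuousOn.mono (closedBall_subset_ball (by norm_num)))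
    refine ⟨M, (norm_nonneg _).trans (hM 0 (mem_closedBall_self (by norm_num))), fun z hz => ?_⟩
    have e1 := sub_smul_dslope H 0 z
    have e2 := sub_smul_dslope (dslope H 0) 0 z
    rw [dslope_same, ← hβ] at e2
    simp only [sub_zero, smul_eq_mul] at e1 e2
    have : H z - H 0 - β * z = dslope (dslope H 0) 0 z * z ^ 2 := by
      linear_combination -e1 - z * e2
    rw [this, norm_mul, norm_pow]
    gcongr
    exact hM z hz
  have key : ∀ ρ : ℝ, 0 < ρ → ρ < 1 / 2 → ‖β‖ * ρ ^ 2 ≤ 1 / 2 →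
      ‖β‖ ^ 2 * (1 - ρ ^ 2) ≤ 1 + 4 * M * ρ + 8 * M ^ 2 * ρ ^ 4 := by
    intro ρ hρ hρ2 hβρ
    have hρ1 : ρ < 1 := by linarith
    have hna : ‖β * ((ρ ^ 2 : ℝ) : ℂ)‖ = ‖β‖ * ρ ^ 2 := by
      rw [norm_mul, norm_real, Real.norm_of_nonneg (by positivity)]
    set t := ‖β‖ * ρ ^ 2 with ht
    have ht0 : 0 ≤ t := by positivity
    have ht1 : 1 / 2 ≤ 1 - t ^ 2 := by nlinarith
    -- As `z = ρ ^ 2 * conj z⁻¹` on the circle, `z⁻¹ + β * z` is `subMulConj (-a) z⁻¹`, which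
    -- `subMulConj a` sends to `(1 - t ^ 2) * z⁻¹`. The remainder grows by at most `1 + t ≤ 2`.
    have hcirc : ∀ z, ‖z‖ = ρ →
        ‖subMulConj (β * ((ρ ^ 2 : ℝ) : ℂ)) (z⁻¹ + H z - H 0)‖ ≤
          (1 - t ^ 2) / ρ + 2 * M * ρ ^ 2 := by
      intro z hz
      have hz0 : z ≠ 0 := norm_pos_iff.1 (hz ▸ hρ)
      have hzc : ((ρ ^ 2 : ℝ) : ℂ) * conj (z⁻¹) = z := by
        rw [← hz, ← Complex.normSq_eq_norm_sq, ← Complex.mul_conj, map_inv₀, mul_assoc,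
          mul_inv_cancel₀ (by simpa using hz0), mul_one]
      have h1 : z⁻¹ + H z - H 0 =
          subMulConj (-(β * ((ρ ^ 2 : ℝ) : ℂ))) (z⁻¹) + (H z - H 0 - β * z) := by
        rw [subMulConj_apply]
        linear_combination -β * hzc
      rw [h1, map_add, subMulConj_subMulConj_neg, hna]
      refine (norm_add_le _ _).trans (add_le_add (le_of_eq ?_) ?_)
      · rw [norm_mul, norm_real, Real.norm_of_nonneg (by linarith), norm_inv, hz]; rfl
      · refine (norm_subMulConj_le _ _).trans ?_
        rw [hna]
        have := hM z (by rw [mem_closedBall_zero_iff, hz]; exact hρ2.le)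
        rw [hz] at this
        calc (1 + t) * ‖H z - H 0 - β * z‖ ≤ 2 * (M * ρ ^ 2) := by
              gcongr; linarith
          _ = _ := by ring
    have h1 := (volume_image_annulus_ge hH hinj hρ hρ1).trans
      (volume_image_annulus_le hH hinj hρ hρ1 (by rw [hna]; linarith)
        (add_nonneg (div_nonneg (by linarith) hρ.le) (by positivity)) hcirc)
    rw [ENNReal.ofReal_le_ofReal_iff (by rw [hna]; have : 0 < 1 - t ^ 2 := by linarith
                                         positivity), hna, ← hβ] at h1
    -- The cross term is exactly `4 * M * ρ`; the constant `8` comes from `1 - t ^ 2 ≥ 1 / 2`.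
    have h2 : ((1 - t ^ 2) / ρ + 2 * M * ρ ^ 2) ^ 2 / (1 - t ^ 2) ≤
        1 / ρ ^ 2 + 4 * M * ρ + 8 * M ^ 2 * ρ ^ 4 := by
      have hpos : 0 < 1 - t ^ 2 := by linarith
      have : ((1 - t ^ 2) / ρ + 2 * M * ρ ^ 2) ^ 2 / (1 - t ^ 2) =
          (1 - t ^ 2) / ρ ^ 2 + 4 * M * ρ + 4 * M ^ 2 * ρ ^ 4 / (1 - t ^ 2) := by
        field_simp
        ring
      rw [this]
      gcongr
      · nlinarith
      · rw [div_le_iff₀ hpos]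
        have : 0 ≤ 8 * M ^ 2 * ρ ^ 4 := by positivity
        nlinarith
    rw [mul_div_assoc] at h1
    have h3 := h1.trans (mul_le_mul_of_nonneg_left h2 Real.pi_pos.le)
    rw [mul_assoc, ← mul_add] at h3
    have := le_of_mul_le_mul_left h3 Real.pi_pos
    linarith
  have hl : Tendsto (fun ρ : ℝ => ‖β‖ ^ 2 * (1 - ρ ^ 2)) (𝓝[>] 0) (𝓝 (‖β‖ ^ 2)) := by
    have : Continuous fun ρ : ℝ => ‖β‖ ^ 2 * (1 - ρ ^ 2) := by fun_prop
    simpa using (this.tendsto 0).mono_left nhdsWithin_le_nhds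
  have hrr : Tendsto (fun ρ : ℝ => 1 + 4 * M * ρ + 8 * M ^ 2 * ρ ^ 4) (𝓝[>] 0) (𝓝 1) := by
    have : Continuous fun ρ : ℝ => 1 + 4 * M * ρ + 8 * M ^ 2 * ρ ^ 4 := by fun_prop
    simpa using (this.tendsto 0).mono_left nhdsWithin_le_nhds
  have hev : ∀ᶠ ρ : ℝ in 𝓝[>] 0,
      ‖β‖ ^ 2 * (1 - ρ ^ 2) ≤ 1 + 4 * M * ρ + 8 * M ^ 2 * ρ ^ 4 := by
    have h1 : ∀ᶠ ρ : ℝ in 𝓝 0, ρ < 1 / 2 := gt_mem_nhds (by norm_num)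
    have h2 : ∀ᶠ ρ : ℝ in 𝓝 0, ‖β‖ * ρ ^ 2 < 1 / 2 := by
      have : Continuous fun ρ : ℝ => ‖β‖ * ρ ^ 2 := by fun_prop
      exact this.tendsto 0 |>.eventually (gt_mem_nhds (by norm_num))
    filter_upwards [h1.filter_mono nhdsWithin_le_nhds, h2.filter_mono nhdsWithin_le_nhds,
      self_mem_nhdsWithin] with ρ h1 h2 h3
    exact key ρ h3 h1 h2.le
  have := le_of_tendsto_of_tendsto hl hrr hev
  nlinarith [norm_nonneg β]

/-! ### Alignment of arguments and conclusion -/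

open Metric Set Filter Topology Complex in
theorem Complex.norm_add_norm_le_of_forall_norm_add_mul_le {a b : ℂ} {r : ℝ}
    (h : ∀ ε : ℂ, ‖ε‖ = 1 → ‖a + ε * b‖ ≤ r) : ‖a‖ + ‖b‖ ≤ r := by
  -- This unimodular factor rotates `b` to the argument of `a`, making the triangle inequality an
  -- equality.
  refine le_trans (le_of_eq ?_) (h (exp ((arg a - arg b : ℝ) * I)) (norm_exp_ofReal_mul_I _))
  have h1 : a + exp ((arg a - arg b : ℝ) * I) * b =
      ((‖a‖ + ‖b‖ : ℝ) : ℂ) * exp (arg a * I) := by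
    conv_lhs => rw [← norm_mul_exp_arg_mul_I a]
    conv_lhs => enter [2, 2]; rw [← norm_mul_exp_arg_mul_I b]
    have : exp ((arg a - arg b : ℝ) * I) * (‖b‖ * exp (arg b * I)) = ‖b‖ * exp (arg a * I) := by
      rw [mul_left_comm, ← exp_add]
      congr 2
      push_cast
      ring
    simp only [norm_mul_exp_arg_mul_I] at this ⊢
    rw [this]
    push_cast
    rw [add_mul, norm_mul_exp_arg_mul_I]
  rw [h1, norm_mul, norm_exp_ofReal_mul_I, mul_one, norm_real, Real.norm_of_nonneg (by positivity)]

open Metric Set Filter Topology Complex in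
theorem corollary3p4 (f : ℂ → ℂ)
    (hf : DifferentiableOn ℂ f (Metric.ball (0 : ℂ) 1))
    (hinj : Set.InjOn f (Metric.ball (0 : ℂ) 1))
    (hbound : ∀ z ∈ Metric.ball (0 : ℂ) 1, ‖f z‖ < 1)
    (hf0 : f 0 = 0) :
    ‖schwarzian f 0‖ ≤ 6 * (1 - ‖deriv f 0‖ ^ 2) := by
  have hU : ball (0 : ℂ) 1 ∈ 𝓝 0 := ball_mem_nhds _ one_pos
  have h0 : (0 : ℂ) ∈ ball (0 : ℂ) 1 := mem_ball_self one_pos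
  have hc : deriv f 0 ≠ 0 := deriv_ne_zero_of_analyticAt_of_injOn (hf.analyticAt hU) hU hinj
  set c := deriv f 0 with hcdef
  set φ := dslope f 0 with hφdef
  set ψ := dslope φ 0 with hψdef
  have hφ : DifferentiableOn ℂ φ (ball 0 1) := (differentiableOn_dslope hU).2 hf
  have hψ : DifferentiableOn ℂ ψ (ball 0 1) := (differentiableOn_dslope hU).2 hφ
  have hφ0 : φ 0 = c := dslope_same f 0
  have hfφ : ∀ z, f z = z * φ z := fun z => by
    have := sub_smul_dslope f 0 z
    rw [sub_zero, hf0, sub_zero, smul_eq_mul] at this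
    exact this.symm
  have hφψ : ∀ z, φ z = c + z * ψ z := fun z => by
    have := sub_smul_dslope φ 0 z
    rw [sub_zero, hφ0, smul_eq_mul] at this
    rw [hψdef, this]; ring
  have hf_ne : ∀ z ∈ ball (0 : ℂ) 1, z ≠ 0 → f z ≠ 0 := fun z hz hz0 h =>
    hz0 (hinj hz h0 (h.trans hf0.symm))
  have hφ_ne : ∀ z ∈ ball (0 : ℂ) 1, φ z ≠ 0 := fun z hz => by
    rcases eq_or_ne z 0 with rfl | hz0
    · rwa [hφ0]
    · exact right_ne_zero_of_mul (hfφ z ▸ hf_ne z hz hz0)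
  have hS : schwarzian f 0 = 6 * ((deriv ψ 0 * c - ψ 0 ^ 2) / c ^ 2) :=
    schwarzian_eq_of_eventuallyEq (hψ.analyticAt hU)
      (Eventually.of_forall fun z => by rw [hfφ, hφψ]) hc
  have hφ' : HasDerivAt φ (ψ 0) 0 := by
    rw [hψdef, dslope_same]
    exact (hφ.differentiableAt hU).hasDerivAt
  have key : ∀ ε : ℂ, ‖ε‖ = 1 →
      ‖(deriv ψ 0 * c - ψ 0 ^ 2) / c ^ 2 + ε * c ^ 2‖ ≤ 1 := by
    intro ε hε
    -- Since `c / (z * φ z) = z⁻¹ - ψ z / φ z`, this is the regular part of `c * ((f z)⁻¹ - ε * f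
    -- z)`.
    set H : ℂ → ℂ := fun z => -(ψ z / φ z) - ε * c * f z with hHdef
    have hH : DifferentiableOn ℂ H (ball 0 1) :=
      ((hψ.div hφ hφ_ne).neg).sub (hf.const_mul _)
    have hHF : ∀ z ∈ ball (0 : ℂ) 1 \ {0}, z⁻¹ + H z = c * ((f z)⁻¹ - ε * f z) := by
      rintro z ⟨hz, hz0⟩
      have hz0' : z ≠ 0 := hz0
      have hψz : ψ z = (φ z - c) / z := by rw [hφψ z]; field_simp; ring
      have := hφ_ne z hz
      simp only [hHdef]
      rw [hψz, hfφ z]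
      field_simp
      ring
    have hHinj : InjOn (fun z => z⁻¹ + H z) (ball 0 1 \ {0}) := by
      intro z hz w hw h
      simp only [hHF z hz, hHF w hw] at h
      refine hinj hz.1 hw.1 (injOn_inv_sub_mul hε ?_ ?_ (mul_left_cancel₀ hc h))
      · exact ⟨mem_ball_zero_iff.2 (hbound z hz.1), hf_ne z hz.1 hz.2⟩
      · exact ⟨mem_ball_zero_iff.2 (hbound w hw.1), hf_ne w hw.1 hw.2⟩
    have hd : HasDerivAt H (-((deriv ψ 0 * c - ψ 0 ^ 2) / c ^ 2 + ε * c ^ 2)) 0 := by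
      have := (((hψ.differentiableAt hU).hasDerivAt.div hφ' (hφ_ne 0 h0)).neg).sub
        ((hf.differentiableAt hU).hasDerivAt.const_mul (ε * c))
      refine this.congr_deriv ?_
      rw [hφ0, ← hcdef]
      ring
    have := norm_deriv_zero_le_one_of_injOn_inv_add hH hHinj
    rwa [hd.deriv, norm_neg] at this
  have := Complex.norm_add_norm_le_of_forall_norm_add_mul_le key
  rw [hS, norm_mul, norm_pow] at *
  norm_num at this ⊢
  linarith
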